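/- A Kreĭn space is a complex vector space $\mathcal H$ with a hermitian sesquilinear form $\langle\cdot,\cdot\rangle_{\mathcal H}$ that admits a fundamental decomposition: an orthogonal direct sum $\mathcal H=\mathcal H_+\oplus\mathcal H_-$ in which $\mathcal H_+$ is a Hilbert space and $\mathcal H_-$ is the antispace of a Hilbert space. It carries its strong topology, the topology of the norm $\|f\|^2=\langle f_+,f_+\rangle_{\mathcal H}-\langle f_-,f_-\rangle_{\mathcal H}$, where $f_\pm$ are the components of $f$ in $\mathcal H_\pm$. The Hilbert space with this norm is an associated Hilbert space of $\mathcal H$, and the dimension of a closed subspace of $\mathcal H$ is its Hilbert space dimension (a cardinal number) in an associated Hilbert space. The indices of $\mathcal H$ are $\operatorname{ind}_\pm\mathcal H=\dim\mathcal H_\pm$. The topology, the dimensions and the indices do not depend on the chosen fundamental decomposition. For Kreĭn spaces $\mathcal A,\mathcal H$, let $\mathcal L(\mathcal A,\mathcal H)$ be the set of continuous everywhere defined linear operators from $\mathcal A$ to $\mathcal H$; the adjoint $A^*\in\mathcal L(\mathcal H,\mathcal A)$ of $A\in\mathcal L(\mathcal A,\mathcal H)$ is determined by $\langle Ax,y\rangle_{\mathcal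 H}=\langle x,A^*y\rangle_{\mathcal A}$. Theorem. Let $C=C^*\in\mathcal L(\mathcal H,\mathcal H)$ be a selfadjoint operator on an arbitrary, not necessarily separable, Kreĭn space $\mathcal H$. Let $h_+(C)$ (respectively $h_-(C)$) be the maximum dimension of a closed subspace $\mathcal M$ of $\mathcal H$ such that $\langle Cf,f\rangle_{\mathcal H}>0$ (respectively $<0$) for every nonzero $f\in\mathcal M$; both maxima are attained. Then for every Kreĭn space $\mathcal A$, there is an operator $A\in\mathcal L(\mathcal A,\mathcal H)$ with $$C=AA^*,\qquad \ker A=\{0\},$$ if and only if $\operatorname{ind}_+\mathcal A=h_+(C)$ and $\operatorname{ind}_-\mathcal A=h_-(C)$. In particular, if $C$ has such factorizations through Kreĭn spaces $\mathcal A$ and $\mathcal B$, then $\operatorname{ind}_\pm\mathcal A=\operatorname{ind}_\pm\mathcal B$. -/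

import Mathlib

open scoped Cardinal

universe u v w

noncomputable section

/-- A complex vector space with a (possibly indefinite) inner product: a sesquilinear hermitian
form `[x, y]`, conjugate linear in `x` and linear in `y` (the convention of Mathlib for `inner`). -/
class IndefiniteInnerProductSpace (H : Type u) [AddCommGroup H] [Module ℂ H] where
  form : H →ₗ⋆[ℂ] H →ₗ[ℂ] ℂ
  conj_form_symm : ∀ x y : H, (starRingEnd ℂ) (form y x) = form x y

namespace Krein

/-- The indefinite inner product `[x, y]`. -/
abbrev form {H : Type u} [AddCommGroup H] [Module ℂ H] [IndefiniteInnerProductSpace H] :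
    H →ₗ⋆[ℂ] H →ₗ[ℂ] ℂ :=
  IndefiniteInnerProductSpace.form

/-- An orthogonal direct sum decomposition of an indefinite inner product space into a positive
definite subspace and a negative definite one (completeness is imposed later). -/
structure DefiniteDecomposition (H : Type u) [AddCommGroup H] [Module ℂ H]
    [IndefiniteInnerProductSpace H] where
  pos : Submodule ℂ H
  neg : Submodule ℂ H
  isCompl : IsCompl pos neg
  orthogonal : ∀ x ∈ pos, ∀ y ∈ neg, form x y = 0
  pos_def : ∀ x ∈ pos, x ≠ 0 → 0 < (form x x).re
  neg_def : ∀ x ∈ neg, x ≠ 0 → (form x x).re < 0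

namespace DefiniteDecomposition

variable {H : Type u} [AddCommGroup H] [Module ℂ H] [IndefiniteInnerProductSpace H]

/-- The component of a vector in the positive subspace. -/
def posPart (D : DefiniteDecomposition H) : H →ₗ[ℂ] H := D.pos.projection D.neg D.isCompl

/-- The component of a vector in the negative subspace. -/
def negPart (D : DefiniteDecomposition H) : H →ₗ[ℂ] H := D.neg.projection D.pos D.isCompl.symm

/-- The vector space `H`, to be equipped with the positive definite inner product
`⟪x, y⟫ = [x₊, y₊] - [x₋, y₋]`. -/
def AssocSpace (_D : DefiniteDecomposition H) : Type u := H

instance (D : DefiniteDecomposition H) : AddCommGroup D.AssocSpace := inferInstanceAs (AddCommGroup H)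

instance (D : DefiniteDecomposition H) : Module ℂ D.AssocSpace := inferInstanceAs (Module ℂ H)

/-- The identity map from `H` to the associated space. -/
def toAssoc (D : DefiniteDecomposition H) : H ≃ₗ[ℂ] D.AssocSpace := LinearEquiv.refl ℂ H

/-- The inner product `[x₊, y₊] - [x₋, y₋]`. -/
def assocInner (D : DefiniteDecomposition H) (x y : H) : ℂ :=
  form (D.posPart x) (D.posPart y) - form (D.negPart x) (D.negPart y)

theorem posPart_mem (D : DefiniteDecomposition H) (x : H) : D.posPart x ∈ D.pos :=
  Submodule.projection_apply_mem _ _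

theorem negPart_mem (D : DefiniteDecomposition H) (x : H) : D.negPart x ∈ D.neg :=
  Submodule.projection_apply_mem _ _

theorem posPart_add_negPart (D : DefiniteDecomposition H) (x : H) :
    D.posPart x + D.negPart x = x :=
  Submodule.projection_add_projection_eq_self D.isCompl x

theorem posPart_of_mem_pos (D : DefiniteDecomposition H) {x : H} (hx : x ∈ D.pos) :
    D.posPart x = x := Submodule.projection_apply_of_mem_left _ hx

theorem negPart_of_mem_pos (D : DefiniteDecomposition H) {x : H} (hx : x ∈ D.pos) :
    D.negPart x = 0 := (Submodule.projection_apply_eq_zero_iff _).2 hx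

theorem posPart_of_mem_neg (D : DefiniteDecomposition H) {x : H} (hx : x ∈ D.neg) :
    D.posPart x = 0 := (Submodule.projection_apply_eq_zero_iff _).2 hx

theorem negPart_of_mem_neg (D : DefiniteDecomposition H) {x : H} (hx : x ∈ D.neg) :
    D.negPart x = x := Submodule.projection_apply_of_mem_left _ hx

theorem form_pos_nonneg (D : DefiniteDecomposition H) {x : H} (hx : x ∈ D.pos) :
    0 ≤ (form x x).re := by
  by_cases h : x = 0
  · simp [h]
  · exact (D.pos_def x hx h).le

theorem form_neg_nonpos (D : DefiniteDecomposition H) {x : H} (hx : x ∈ D.neg) :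
    (form x x).re ≤ 0 := by
  by_cases h : x = 0
  · simp [h]
  · exact (D.neg_def x hx h).le

/-- The associated inner product is positive definite. -/
@[reducible] def assocCore (D : DefiniteDecomposition H) : InnerProductSpace.Core ℂ D.AssocSpace where
  inner x y := D.assocInner (D.toAssoc.symm x) (D.toAssoc.symm y)
  conj_inner_symm x y := by
    simp [assocInner, IndefiniteInnerProductSpace.conj_form_symm]
  re_inner_nonneg x := by
    have h1 := D.form_pos_nonneg (D.posPart_mem (D.toAssoc.symm x))
    have h2 := D.form_neg_nonpos (D.negPart_mem (D.toAssoc.symm x))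
    simp only [assocInner, map_sub, RCLike.re_to_complex]
    linarith
  add_left x y z := by simp [assocInner]; ring
  smul_left x y r := by simp [assocInner]; ring
  definite x hx := by
    have h1 := D.form_pos_nonneg (D.posPart_mem (D.toAssoc.symm x))
    have h2 := D.form_neg_nonpos (D.negPart_mem (D.toAssoc.symm x))
    have h3 := congrArg Complex.re hx
    simp only [assocInner, Complex.sub_re, Complex.zero_re] at h3
    have h4 : D.posPart (D.toAssoc.symm x) = 0 := by
      by_contra h
      have := D.pos_def _ (D.posPart_mem _) h
      linarith
    have h5 : D.negPart (D.toAssoc.symm x) = 0 := by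
      by_contra h
      have := D.neg_def _ (D.negPart_mem _) h
      linarith
    have h6 := D.posPart_add_negPart (D.toAssoc.symm x)
    rw [h4, h5, add_zero] at h6
    exact D.toAssoc.symm.map_eq_zero_iff.1 h6.symm

instance (D : DefiniteDecomposition H) : NormedAddCommGroup D.AssocSpace :=
  D.assocCore.toNormedAddCommGroup

instance (D : DefiniteDecomposition H) : InnerProductSpace ℂ D.AssocSpace :=
  InnerProductSpace.ofCore D.assocCore.toCore

/-- The decomposition is fundamental if both components are complete for their intrinsic norms,
i.e. the positive one is a Hilbert space and the negative one the antispace of a Hilbert space. -/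
def IsFundamental (D : DefiniteDecomposition H) : Prop :=
  IsComplete (D.toAssoc '' (D.pos : Set H)) ∧ IsComplete (D.toAssoc '' (D.neg : Set H))

theorem inner_def (D : DefiniteDecomposition H) (x y : H) :
    inner ℂ (D.toAssoc x) (D.toAssoc y) = D.assocInner x y := rfl


/-- The operator `x ↦ x₊ - x₋` (the fundamental symmetry), on the associated space. -/
def symmetry (D : DefiniteDecomposition H) : D.AssocSpace →ₗ[ℂ] D.AssocSpace :=
  D.toAssoc.toLinearMap ∘ₗ (D.posPart - D.negPart) ∘ₗ D.toAssoc.symm.toLinearMap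

theorem posPart_symm (D : DefiniteDecomposition H) (x : H) :
    D.posPart (D.posPart x - D.negPart x) = D.posPart x := by
  rw [map_sub, D.posPart_of_mem_pos (D.posPart_mem x), D.posPart_of_mem_neg (D.negPart_mem x),
    sub_zero]

theorem negPart_symm (D : DefiniteDecomposition H) (x : H) :
    D.negPart (D.posPart x - D.negPart x) = -D.negPart x := by
  rw [map_sub, D.negPart_of_mem_pos (D.posPart_mem x), D.negPart_of_mem_neg (D.negPart_mem x),
    zero_sub]

theorem symmetry_symmetry (D : DefiniteDecomposition H) (x : D.AssocSpace) :
    D.symmetry (D.symmetry x) = x := by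
  obtain ⟨x, rfl⟩ := D.toAssoc.surjective x
  have : D.symmetry (D.symmetry (D.toAssoc x)) =
    D.toAssoc (D.posPart (D.posPart x - D.negPart x) - D.negPart (D.posPart x - D.negPart x)) :=
    rfl
  rw [this, posPart_symm, negPart_symm, sub_neg_eq_add, posPart_add_negPart]

theorem form_eq (D : DefiniteDecomposition H) (x y : H) :
    form x y = form (D.posPart x) (D.posPart y) + form (D.negPart x) (D.negPart y) := by
  conv_lhs => rw [← D.posPart_add_negPart x, ← D.posPart_add_negPart y]
  have h1 := D.orthogonal _ (D.posPart_mem x) _ (D.negPart_mem y)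
  have h2 : form (D.negPart x) (D.posPart y) = 0 := by
    rw [form, ← IndefiniteInnerProductSpace.conj_form_symm]
    have := D.orthogonal _ (D.posPart_mem y) _ (D.negPart_mem x)
    rw [form] at this
    rw [this, map_zero]
  simp only [map_add, LinearMap.add_apply, h1, h2]
  ring

theorem form_eq_inner_left (D : DefiniteDecomposition H) (x y : H) :
    form x y = inner ℂ (D.symmetry (D.toAssoc x)) (D.toAssoc y) := by
  have : D.symmetry (D.toAssoc x) = D.toAssoc (D.posPart x - D.negPart x) := rfl
  rw [this, inner_def, assocInner, posPart_symm, negPart_symm, D.form_eq x y]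
  simp

theorem form_eq_inner_right (D : DefiniteDecomposition H) (x y : H) :
    form x y = inner ℂ (D.toAssoc x) (D.symmetry (D.toAssoc y)) := by
  have : D.symmetry (D.toAssoc y) = D.toAssoc (D.posPart y - D.negPart y) := rfl
  rw [this, inner_def, assocInner, posPart_symm, negPart_symm, D.form_eq x y]
  simp

theorem inner_self_re (D : DefiniteDecomposition H) (x : H) :
    ‖D.toAssoc x‖ ^ 2 = (form (D.posPart x) (D.posPart x)).re
      - (form (D.negPart x) (D.negPart x)).re := by
  rw [← inner_self_eq_norm_sq (𝕜 := ℂ), inner_def, assocInner]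
  simp

theorem norm_symmetry (D : DefiniteDecomposition H) (x : D.AssocSpace) :
    ‖D.symmetry x‖ = ‖x‖ := by
  have h : ‖D.symmetry x‖ ^ 2 = ‖x‖ ^ 2 := by
    obtain ⟨x, rfl⟩ := D.toAssoc.surjective x
    have : D.symmetry (D.toAssoc x) = D.toAssoc (D.posPart x - D.negPart x) := rfl
    rw [this, inner_self_re, inner_self_re, posPart_symm, negPart_symm]
    simp
  nlinarith [norm_nonneg x, norm_nonneg (D.symmetry x), sq_nonneg (‖D.symmetry x‖ - ‖x‖)]

/-- The fundamental symmetry as a continuous operator. -/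
def symmetryL (D : DefiniteDecomposition H) : D.AssocSpace →L[ℂ] D.AssocSpace :=
  D.symmetry.mkContinuous 1 fun x => by rw [norm_symmetry, one_mul]

theorem norm_posPart_le (D : DefiniteDecomposition H) (x : H) :
    ‖D.toAssoc (D.posPart x)‖ ≤ ‖D.toAssoc x‖ := by
  refine abs_le_of_sq_le_sq' ?_ (norm_nonneg _) |>.2
  rw [inner_self_re, inner_self_re, D.posPart_of_mem_pos (D.posPart_mem x),
    D.negPart_of_mem_pos (D.posPart_mem x)]
  have := D.form_neg_nonpos (D.negPart_mem x)
  simpa using this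

theorem norm_negPart_le (D : DefiniteDecomposition H) (x : H) :
    ‖D.toAssoc (D.negPart x)‖ ≤ ‖D.toAssoc x‖ := by
  refine abs_le_of_sq_le_sq' ?_ (norm_nonneg _) |>.2
  rw [inner_self_re, inner_self_re, D.posPart_of_mem_neg (D.negPart_mem x),
    D.negPart_of_mem_neg (D.negPart_mem x)]
  have := D.form_pos_nonneg (D.posPart_mem x)
  simpa using this

/-- The projection to the positive component as a continuous operator. -/
def posPartL (D : DefiniteDecomposition H) : D.AssocSpace →L[ℂ] D.AssocSpace :=
  (D.toAssoc.toLinearMap ∘ₗ D.posPart ∘ₗ D.toAssoc.symm.toLinearMap).mkContinuous 1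
    fun x => by rw [one_mul]; exact D.norm_posPart_le (D.toAssoc.symm x)

/-- The projection to the negative component as a continuous operator. -/
def negPartL (D : DefiniteDecomposition H) : D.AssocSpace →L[ℂ] D.AssocSpace :=
  (D.toAssoc.toLinearMap ∘ₗ D.negPart ∘ₗ D.toAssoc.symm.toLinearMap).mkContinuous 1
    fun x => by rw [one_mul]; exact D.norm_negPart_le (D.toAssoc.symm x)

/-- The associated space of a fundamental decomposition is a Hilbert space. -/
theorem IsFundamental.completeSpace {D : DefiniteDecomposition H} (hD : D.IsFundamental) :
    CompleteSpace D.AssocSpace := by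
  refine Metric.complete_of_cauchySeq_tendsto fun s hs => ?_
  obtain ⟨a, -, ha⟩ := cauchySeq_tendsto_of_isComplete hD.1
    (u := fun n => D.posPartL (s n)) (fun n => ⟨_, D.posPart_mem _, rfl⟩)
    (D.posPartL.uniformContinuous.comp_cauchySeq hs)
  obtain ⟨b, -, hb⟩ := cauchySeq_tendsto_of_isComplete hD.2
    (u := fun n => D.negPartL (s n)) (fun n => ⟨_, D.negPart_mem _, rfl⟩)
    (D.negPartL.uniformContinuous.comp_cauchySeq hs)
  refine ⟨a + b, (ha.add hb).congr fun n => ?_⟩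
  exact D.posPart_add_negPart (D.toAssoc.symm (s n))

theorem eq_zero_of_form (D : DefiniteDecomposition H) {x : H} (h : ∀ y, form x y = 0) :
    x = 0 := by
  have h1 := h (D.posPart x - D.negPart x)
  rw [D.form_eq_inner_right] at h1
  have h2 : D.symmetry (D.toAssoc (D.posPart x - D.negPart x)) = D.toAssoc x :=
    D.symmetry_symmetry (D.toAssoc x)
  rw [h2, inner_self_eq_zero] at h1
  exact D.toAssoc.map_eq_zero_iff.1 h1

theorem continuous_form (D : DefiniteDecomposition H) (y : H) :
    Continuous fun x : D.AssocSpace => form (D.toAssoc.symm x) y := by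
  have : (fun x : D.AssocSpace => form (D.toAssoc.symm x) y) =
      fun x : D.AssocSpace => inner ℂ x (D.symmetry (D.toAssoc y)) := by
    funext x
    rw [D.form_eq_inner_right, LinearEquiv.apply_symm_apply]
  rw [this]
  fun_prop

/-- Any two fundamental decompositions give equivalent norms. -/
theorem IsFundamental.continuous_change {D E : DefiniteDecomposition H} (hD : D.IsFundamental)
    (hE : E.IsFundamental) : Continuous (D.toAssoc.symm.trans E.toAssoc) := by
  have := hD.completeSpace
  have := hE.completeSpace
  refine LinearMap.continuous_of_seq_closed_graph
    (g := (D.toAssoc.symm.trans E.toAssoc).toLinearMap) fun s x y hx hy => ?_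
  obtain ⟨y, rfl⟩ := E.toAssoc.surjective y
  obtain ⟨x, rfl⟩ := D.toAssoc.surjective x
  have : y - x = 0 := D.eq_zero_of_form fun z => by
    have h1 := ((E.continuous_form z).tendsto _).comp hy
    have h2 := ((D.continuous_form z).tendsto _).comp hx
    have h3 := tendsto_nhds_unique h1 h2
    simp only [LinearEquiv.symm_apply_apply] at h3
    rw [map_sub, LinearMap.sub_apply, h3, sub_self]
  rw [sub_eq_zero.1 this]
  rfl

end DefiniteDecomposition

/-- A maximal orthonormal subset exists in every inner product space. -/
theorem exists_maximal_orthonormal_set (E : Type u) [NormedAddCommGroup E]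
    [InnerProductSpace ℂ E] :
    ∃ s : Set E, Orthonormal ℂ (Subtype.val : s → E) ∧
      ∀ t ⊇ s, Orthonormal ℂ (Subtype.val : t → E) → t = s := by
  obtain ⟨s, -, h⟩ := exists_maximal_orthonormal (𝕜 := ℂ) (orthonormal_empty ℂ E)
  exact ⟨s, h⟩

/-- The Hilbert dimension: the cardinality of a maximal orthonormal set (for a Hilbert space,
of an orthonormal basis in the sense of Hilbert spaces; it does not depend on the choice). -/
def hilbertDim (E : Type u) [NormedAddCommGroup E] [InnerProductSpace ℂ E] : Cardinal.{u} :=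
  #(exists_maximal_orthonormal_set E).choose

theorem mk_orthonormal_le {E : Type u} {F : Type v} [NormedAddCommGroup E]
    [InnerProductSpace ℂ E] [CompleteSpace E] [NormedAddCommGroup F] [InnerProductSpace ℂ F]
    [CompleteSpace F] (T : E →L[ℂ] F) (hT : Function.Injective T) (s : Set E)
    (hs : Orthonormal ℂ (Subtype.val : s → E)) (t : Set F)
    (ht : Orthonormal ℂ (Subtype.val : t → F))
    (ht' : ∀ r ⊇ t, Orthonormal ℂ (Subtype.val : r → F) → r = t) :
    Cardinal.lift.{v} #s ≤ Cardinal.lift.{u} #t := by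
  have hbot := (maximal_orthonormal_iff_orthogonalComplement_eq_bot ht).1 ht'
  rcases finite_or_infinite t with hfin | hinf
  · have : FiniteDimensional ℂ (Submodule.span ℂ t) :=
      FiniteDimensional.span_of_finite ℂ (Set.toFinite t)
    have htop : Submodule.span ℂ t = ⊤ := (Submodule.orthogonal_eq_bot_iff).1 hbot
    have hli : LinearIndependent ℂ (fun x : s => T x) :=
      hs.linearIndependent.map' T.toLinearMap (LinearMap.ker_eq_bot.2 hT)
    have h1 := hli.cardinal_lift_le_rank
    have h2 : Module.rank ℂ F ≤ #t := by
      have := rank_span_le (R := ℂ) t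
      rwa [htop, rank_top] at this
    exact h1.trans (Cardinal.lift_le.2 h2)
  · have hcov : ∀ x : s, ∃ y : t, inner ℂ (y : F) (T x) ≠ 0 := by
      intro x
      by_contra! h
      have : T (x : E) ∈ (Submodule.span ℂ t)ᗮ := by
        rw [Submodule.mem_orthogonal]
        intro u hu
        induction hu using Submodule.span_induction with
        | mem u hu => exact h ⟨u, hu⟩
        | zero => simp
        | add a b _ _ ha hb => rw [inner_add_left, ha, hb, add_zero]
        | smul c a _ ha => rw [inner_smul_left, ha, mul_zero]
      rw [hbot, Submodule.mem_bot] at this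
      exact hs.ne_zero x (hT (by rw [this, map_zero]))
    choose f hf using hcov
    have hfib : ∀ y : t, #(f ⁻¹' {y}) ≤ ℵ₀ := by
      intro y
      rw [Cardinal.le_aleph0_iff_set_countable]
      have hsum := hs.inner_products_summable (x := T.adjoint (y : F))
      refine hsum.countable_support.mono fun x hx => ?_
      have hx' : f x = y := hx
      have := hf x
      rw [hx'] at this
      rw [Function.mem_support]
      rw [← ContinuousLinearMap.adjoint_inner_left] at this
      intro h
      have h2 : inner ℂ (x : E) (T.adjoint (y : F)) = 0 := by simpa using h
      exact this (inner_eq_zero_symm.1 h2)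
    have hfib' : ∀ y : t, Cardinal.lift.{v} #(f ⁻¹' {y}) ≤ ℵ₀ := fun y =>
      Cardinal.lift_le_aleph0.2 (hfib y)
    have h1 := Cardinal.lift_mk_le_lift_mk_mul_of_lift_mk_preimage_le f hfib'
    refine h1.trans_eq (Cardinal.mul_aleph0_eq ?_)
    rw [← Cardinal.lift_aleph0.{u}, Cardinal.lift_le]
    exact Cardinal.aleph0_le_mk t

/-- An injective continuous operator between Hilbert spaces does not decrease the dimension. -/
theorem hilbertDim_le {E : Type u} {F : Type v} [NormedAddCommGroup E]
    [InnerProductSpace ℂ E] [CompleteSpace E] [NormedAddCommGroup F] [InnerProductSpace ℂ F]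
    [CompleteSpace F] (T : E →L[ℂ] F) (hT : Function.Injective T) :
    Cardinal.lift.{v} (hilbertDim E) ≤ Cardinal.lift.{u} (hilbertDim F) :=
  mk_orthonormal_le T hT _ (exists_maximal_orthonormal_set E).choose_spec.1 _
    (exists_maximal_orthonormal_set F).choose_spec.1
    (exists_maximal_orthonormal_set F).choose_spec.2

/-- The Hilbert dimension is the cardinality of every maximal orthonormal set. -/
theorem hilbertDim_eq_mk {E : Type u} [NormedAddCommGroup E] [InnerProductSpace ℂ E]
    [CompleteSpace E] (s : Set E) (hs : Orthonormal ℂ (Subtype.val : s → E))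
    (hs' : ∀ t ⊇ s, Orthonormal ℂ (Subtype.val : t → E) → t = s) : hilbertDim E = #s := by
  obtain ⟨h1, h2⟩ := (exists_maximal_orthonormal_set E).choose_spec
  have a := mk_orthonormal_le (ContinuousLinearMap.id ℂ E) Function.injective_id _ h1 s hs hs'
  have b := mk_orthonormal_le (ContinuousLinearMap.id ℂ E) Function.injective_id s hs _ h1 h2
  exact le_antisymm (by simpa [hilbertDim] using a) (by simpa [hilbertDim] using b)

/-- The dimension of a subspace of `H` in the Hilbert space associated with a decomposition. -/
def DefiniteDecomposition.dim {H : Type u} [AddCommGroup H] [Module ℂ H]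
    [IndefiniteInnerProductSpace H] (D : DefiniteDecomposition H) (M : Submodule ℂ H) :
    Cardinal.{u} :=
  hilbertDim (M.map D.toAssoc.toLinearMap)

end Krein

/-- A Kreĭn space: an indefinite inner product space which admits a fundamental decomposition,
equipped with its strong topology, i.e. the topology of the Hilbert space associated with a
fundamental decomposition (all of these topologies coincide). -/
class KreinSpace (H : Type u) [AddCommGroup H] [Module ℂ H] [TopologicalSpace H] extends
    IndefiniteInnerProductSpace H where
  exists_fundamental : ∃ D : Krein.DefiniteDecomposition H, D.IsFundamental ∧ IsHomeomorph D.toAssoc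

namespace Krein

section

variable (H : Type u) [AddCommGroup H] [Module ℂ H] [TopologicalSpace H] [KreinSpace H]

/-- A choice of a fundamental decomposition. -/
def decomp : DefiniteDecomposition H := (KreinSpace.exists_fundamental (H := H)).choose

theorem decomp_isFundamental : (decomp H).IsFundamental :=
  (KreinSpace.exists_fundamental (H := H)).choose_spec.1

variable {H}

/-- Every fundamental decomposition induces the strong topology. -/
theorem DefiniteDecomposition.IsFundamental.isHomeomorph {D : DefiniteDecomposition H}
    (hD : D.IsFundamental) : IsHomeomorph D.toAssoc := by
  have h0 := (KreinSpace.exists_fundamental (H := H)).choose_spec.2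
  have hE := decomp_isFundamental H
  let e : (decomp H).AssocSpace ≃ₜ D.AssocSpace :=
    { toEquiv := ((decomp H).toAssoc.symm.trans D.toAssoc).toEquiv
      continuous_toFun := hE.continuous_change hD
      continuous_invFun := hD.continuous_change hE }
  exact e.isHomeomorph.comp h0

/-- The identity from a Kreĭn space to the Hilbert space associated with a fundamental
decomposition. -/
def DefiniteDecomposition.IsFundamental.toAssocL {D : DefiniteDecomposition H}
    (hD : D.IsFundamental) : H ≃L[ℂ] D.AssocSpace :=
  { D.toAssoc with
    continuous_toFun := hD.isHomeomorph.continuous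
    continuous_invFun := (D.toAssoc.toEquiv.continuous_symm_iff).2 hD.isHomeomorph.isOpenMap }

/-- The dimension of a closed subspace of a Kreĭn space, taken in an associated Hilbert space. -/
def dim (M : Submodule ℂ H) : Cardinal.{u} := (decomp H).dim M

variable (H) in
/-- The positive index `ind₊ H`: the dimension of `H₊` in a fundamental decomposition. -/
def posIndex : Cardinal.{u} := dim (decomp H).pos

variable (H) in
/-- The negative index `ind₋ H`: the dimension of `H₋` in a fundamental decomposition. -/
def negIndex : Cardinal.{u} := dim (decomp H).neg

theorem DefiniteDecomposition.IsFundamental.complete_map {D : DefiniteDecomposition H}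
    (hD : D.IsFundamental) {M : Submodule ℂ H} (hM : IsClosed (M : Set H)) :
    CompleteSpace (M.map D.toAssoc.toLinearMap) := by
  have := hD.completeSpace
  exact (hD.isHomeomorph.isClosedMap _ hM).isComplete.completeSpace_coe

theorem DefiniteDecomposition.IsFundamental.isClosed_pos {D : DefiniteDecomposition H}
    (hD : D.IsFundamental) : IsClosed (D.pos : Set H) := by
  have := hD.1.isClosed.preimage hD.isHomeomorph.continuous
  rwa [Set.preimage_image_eq _ D.toAssoc.injective] at this

theorem DefiniteDecomposition.IsFundamental.isClosed_neg {D : DefiniteDecomposition H}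
    (hD : D.IsFundamental) : IsClosed (D.neg : Set H) := by
  have := hD.2.isClosed.preimage hD.isHomeomorph.continuous
  rwa [Set.preimage_image_eq _ D.toAssoc.injective] at this

/-- An operator which is injective on a closed subspace does not decrease its dimension. -/
theorem dim_le_of_injOn {D E : DefiniteDecomposition H} (hD : D.IsFundamental)
    (hE : E.IsFundamental) {M N : Submodule ℂ H} (hM : IsClosed (M : Set H))
    (hN : IsClosed (N : Set H)) (T : H →L[ℂ] H) (hT : ∀ x ∈ M, T x ∈ N)
    (hT' : ∀ x ∈ M, T x = 0 → x = 0) : D.dim M ≤ E.dim N := by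
  have := hD.complete_map hM
  have := hE.complete_map hN
  let S : D.AssocSpace →L[ℂ] E.AssocSpace :=
    hE.toAssocL.toContinuousLinearMap ∘L T ∘L hD.toAssocL.symm.toContinuousLinearMap
  have hS : ∀ x : M.map D.toAssoc.toLinearMap, S x ∈ N.map E.toAssoc.toLinearMap := by
    rintro ⟨_, x, hx, rfl⟩
    exact ⟨T x, hT x hx, rfl⟩
  let S' := (S ∘L (M.map D.toAssoc.toLinearMap).subtypeL).codRestrict _ hS
  have hinj : Function.Injective S' := by
    rw [injective_iff_map_eq_zero]
    rintro ⟨_, x, hx, rfl⟩ h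
    have h' : E.toAssoc (T x) = 0 := congrArg Subtype.val h
    have := hT' x hx (E.toAssoc.map_eq_zero_iff.1 h')
    subst this
    exact Subtype.ext (map_zero _)
  have := hilbertDim_le S' hinj
  rwa [Cardinal.lift_id, Cardinal.lift_id] at this

/-- The dimension of a closed subspace does not depend on the associated Hilbert space. -/
theorem dim_eq {D : DefiniteDecomposition H} (hD : D.IsFundamental) {M : Submodule ℂ H}
    (hM : IsClosed (M : Set H)) : dim M = D.dim M :=
  le_antisymm
    (dim_le_of_injOn (decomp_isFundamental H) hD hM hM (.id ℂ H) (fun _ h => h) fun _ _ h => h)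
    (dim_le_of_injOn hD (decomp_isFundamental H) hM hM (.id ℂ H) (fun _ h => h) fun _ _ h => h)

theorem dim_pos_le {D E : DefiniteDecomposition H} (hD : D.IsFundamental)
    (hE : E.IsFundamental) : dim D.pos ≤ dim E.pos := by
  refine dim_le_of_injOn (decomp_isFundamental H) (decomp_isFundamental H) hD.isClosed_pos
    hE.isClosed_pos
    (hE.toAssocL.symm.toContinuousLinearMap ∘L E.posPartL ∘L hE.toAssocL.toContinuousLinearMap)
    (fun x _ => E.posPart_mem x) fun x hx h => ?_
  have h0 : E.posPart x = 0 := h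
  have h1 := E.posPart_add_negPart x
  rw [h0, zero_add] at h1
  have h2 := E.form_neg_nonpos (h1 ▸ E.negPart_mem x)
  by_contra h3
  exact absurd (D.pos_def x hx h3) h2.not_gt

theorem dim_neg_le {D E : DefiniteDecomposition H} (hD : D.IsFundamental)
    (hE : E.IsFundamental) : dim D.neg ≤ dim E.neg := by
  refine dim_le_of_injOn (decomp_isFundamental H) (decomp_isFundamental H) hD.isClosed_neg
    hE.isClosed_neg
    (hE.toAssocL.symm.toContinuousLinearMap ∘L E.negPartL ∘L hE.toAssocL.toContinuousLinearMap)
    (fun x _ => E.negPart_mem x) fun x hx h => ?_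
  have h0 : E.negPart x = 0 := h
  have h1 := E.posPart_add_negPart x
  rw [h0, add_zero] at h1
  have h2 := E.form_pos_nonneg (h1 ▸ E.posPart_mem x)
  by_contra h3
  exact absurd (D.neg_def x hx h3) h2.not_gt

/-- The positive index does not depend on the fundamental decomposition. -/
theorem posIndex_eq {D : DefiniteDecomposition H} (hD : D.IsFundamental) :
    posIndex H = dim D.pos :=
  le_antisymm (dim_pos_le (decomp_isFundamental H) hD) (dim_pos_le hD (decomp_isFundamental H))

/-- The negative index does not depend on the fundamental decomposition. -/
theorem negIndex_eq {D : DefiniteDecomposition H} (hD : D.IsFundamental) :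
    negIndex H = dim D.neg :=
  le_antisymm (dim_neg_le (decomp_isFundamental H) hD) (dim_neg_le hD (decomp_isFundamental H))

end

section Adjoint

variable {H : Type u} [AddCommGroup H] [Module ℂ H] [TopologicalSpace H] [KreinSpace H]
variable {K : Type v} [AddCommGroup K] [Module ℂ K] [TopologicalSpace K] [KreinSpace K]

instance : CompleteSpace (decomp H).AssocSpace := (decomp_isFundamental H).completeSpace

/-- The Kreĭn space adjoint `A*` of a continuous operator `A`. It is the unique operator with
`[A x, y] = [x, A* y]`. -/
def adjoint (A : K →L[ℂ] H) : H →L[ℂ] K :=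
  let eH : H ≃L[ℂ] (decomp H).AssocSpace := (decomp_isFundamental H).toAssocL
  let eK : K ≃L[ℂ] (decomp K).AssocSpace := (decomp_isFundamental K).toAssocL
  eK.symm.toContinuousLinearMap ∘L (decomp K).symmetryL ∘L
    ContinuousLinearMap.adjoint
      (eH.toContinuousLinearMap ∘L A ∘L eK.symm.toContinuousLinearMap) ∘L
    (decomp H).symmetryL ∘L eH.toContinuousLinearMap

theorem form_adjoint_right (A : K →L[ℂ] H) (x : K) (y : H) :
    form (A x) y = form x (adjoint A y) := by
  have h := ContinuousLinearMap.adjoint_inner_right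
    ((decomp_isFundamental H).toAssocL.toContinuousLinearMap ∘L A ∘L
      (decomp_isFundamental K).toAssocL.symm.toContinuousLinearMap)
    ((decomp K).toAssoc x) ((decomp H).symmetry ((decomp H).toAssoc y))
  rw [(decomp H).form_eq_inner_right, (decomp K).form_eq_inner_right]
  have h2 : (decomp K).toAssoc (adjoint A y) = (decomp K).symmetry (ContinuousLinearMap.adjoint
    ((decomp_isFundamental H).toAssocL.toContinuousLinearMap ∘L A ∘L
      (decomp_isFundamental K).toAssocL.symm.toContinuousLinearMap)
      ((decomp H).symmetry ((decomp H).toAssoc y))) := rfl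
  rw [h2, DefiniteDecomposition.symmetry_symmetry, h]
  rfl

theorem eq_adjoint (A : K →L[ℂ] H) (B : H →L[ℂ] K)
    (h : ∀ x y, form (A x) y = form x (B y)) : B = adjoint A := by
  ext y
  rw [← sub_eq_zero]
  refine (decomp K).eq_zero_of_form fun x => ?_
  rw [form, ← IndefiniteInnerProductSpace.conj_form_symm]
  have h1 := h x y
  rw [form_adjoint_right] at h1
  rw [map_sub]
  simp only [form] at h1
  rw [h1, sub_self, map_zero]

/-- An operator on a Kreĭn space is selfadjoint if `C* = C`. -/
def IsSelfadjoint (C : H →L[ℂ] H) : Prop := adjoint C = C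

/-- `M` is `C`-strictly positive: `[C f, f] > 0` for all nonzero `f` in `M`. -/
def IsStrictlyPositive (C : H →L[ℂ] H) (M : Submodule ℂ H) : Prop :=
  ∀ f ∈ M, f ≠ 0 → 0 < (form (C f) f).re

/-- `M` is `C`-strictly negative: `[C f, f] < 0` for all nonzero `f` in `M`. -/
def IsStrictlyNegative (C : H →L[ℂ] H) (M : Submodule ℂ H) : Prop :=
  ∀ f ∈ M, f ≠ 0 → (form (C f) f).re < 0

/-- The dimensions of the closed `C`-strictly positive subspaces. -/
def positiveDims (C : H →L[ℂ] H) : Set Cardinal.{u} :=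
  {κ | ∃ M : Submodule ℂ H, IsClosed (M : Set H) ∧ IsStrictlyPositive C M ∧ dim M = κ}

/-- The dimensions of the closed `C`-strictly negative subspaces. -/
def negativeDims (C : H →L[ℂ] H) : Set Cardinal.{u} :=
  {κ | ∃ M : Submodule ℂ H, IsClosed (M : Set H) ∧ IsStrictlyNegative C M ∧ dim M = κ}

/-- The positive hermitian index `h₊(C)`: the maximum (taken as a supremum) dimension of a closed
`C`-strictly positive subspace. -/
def posHermitianIndex (C : H →L[ℂ] H) : Cardinal.{u} := sSup (positiveDims C)

/-- The negative hermitian index `h₋(C)`: the maximum (taken as a supremum) dimension of a closed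
`C`-strictly negative subspace. -/
def negHermitianIndex (C : H →L[ℂ] H) : Cardinal.{u} := sSup (negativeDims C)

/-- `C` admits a Bognár–Krámli factorization `C = A A*` through `K`, with `ker A = {0}`. -/
def HasBognarKramliFactorization (C : H →L[ℂ] H) (K : Type v) [AddCommGroup K] [Module ℂ K]
    [TopologicalSpace K] [KreinSpace K] : Prop :=
  ∃ A : K →L[ℂ] H, LinearMap.ker A.toLinearMap = ⊥ ∧ C = A ∘L adjoint A

end Adjoint

end Krein

end

/-! Let `J` be the fundamental symmetry. On the associated Hilbert space the form `[C x, y]` is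
given by the selfadjoint operator `J C` (`gramOperator`). The functional calculus writes it as `R² -
T²` with `R`, `T` selfadjoint and `R T = T R = 0`, so `[C f, f] = ‖R f‖² - ‖T f‖²`. This is
nonpositive on `ker R` and positive on `(ker R)ᗮ`, where `T` vanishes. A closed `C`-positive
subspace meets `ker R` only in `0`, so it projects injectively into `(ker R)ᗮ`, which is itself
`C`-positive: the maximum is `dim (ker R)ᗮ`. Likewise the negative maximum is `dim (ker T)ᗮ`.

If `C = A A*`, let `B`, `B'` be the components of `A*` in `K₊`, `K₋`. Then `[C f, f] = ‖B f‖² - ‖B'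
f‖²`, and `ker A = 0` says that `B†` and `B'†` are jointly injective. `K₊` and `(ker R)ᗮ` inject
into each other (`hilbertDim_eq_of_definite`). In one direction `B` is injective on `(ker R)ᗮ`. In
the other, `‖B f‖ ≤ ‖B' f‖` on `ker R` gives a bounded `S` with `B = S B'` there; then `B† - B'† S†`
has range orthogonal to `ker R` and is injective. Continuous injections, with no condition on the
range, suffice to compare Hilbert dimensions, so separability plays no role.

Conversely, equal dimensions give unitaries `U : (ker R)ᗮ → K₊` and `U' : (ker T)ᗮ → K₋`, and `B = U
R`, `B' = U' T` are the components of `A*` for a factorization. -/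

noncomputable section

namespace Krein

/-! ### Selfadjoint operators and comparison of dimensions in Hilbert spaces. -/

section Hilbert

open ContinuousLinearMap
open scoped InnerProduct

variable {G : Type u} [NormedAddCommGroup G] [InnerProductSpace ℂ G] [CompleteSpace G]

/-- A selfadjoint operator is a difference of squares of selfadjoint operators whose products
vanish. -/
theorem exists_eq_sub_of_isSelfAdjoint (S : G →L[ℂ] G) (hS : IsSelfAdjoint S) :
    ∃ R T : G →L[ℂ] G, IsSelfAdjoint R ∧ IsSelfAdjoint T ∧ R * R - T * T = S ∧
      R * T = 0 ∧ T * R = 0 := by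
  -- The real square root is `0` on negative numbers, so these are the square roots of the positive
  -- and negative parts of `S`.
  refine ⟨cfc (fun x : ℝ => √x) S, cfc (fun x : ℝ => √(-x)) S, cfc_predicate _ _,
    cfc_predicate _ _, ?_, ?_, ?_⟩
  · rw [← cfc_mul .., ← cfc_mul .., ← cfc_sub ..]
    conv_rhs => rw [← cfc_id ℝ S]
    refine cfc_congr fun x _ => ?_
    rcases le_total 0 x with h | h
    · simp [Real.mul_self_sqrt h, Real.sqrt_eq_zero_of_nonpos (neg_nonpos.2 h)]
    · simp [Real.mul_self_sqrt (neg_nonneg.2 h), Real.sqrt_eq_zero_of_nonpos h]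
  all_goals
    rw [← cfc_mul .., ← cfc_zero ℝ S]
    refine cfc_congr fun x _ => ?_
    rcases le_total 0 x with h | h
    · simp [Real.sqrt_eq_zero_of_nonpos (neg_nonpos.2 h)]
    · simp [Real.sqrt_eq_zero_of_nonpos h]

theorem inner_sub_sq_apply {R T : G →L[ℂ] G} (hR : IsSelfAdjoint R) (hT : IsSelfAdjoint T)
    (f : G) : (inner ℂ ((R * R - T * T) f) f).re = ‖R f‖ ^ 2 - ‖T f‖ ^ 2 := by
  have h : ∀ A : G →L[ℂ] G, IsSelfAdjoint A → (inner ℂ (A (A f)) f).re = ‖A f‖ ^ 2 := by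
    intro A hA
    rw [← inner_self_eq_norm_sq (𝕜 := ℂ), ← adjoint_inner_right, hA.adjoint_eq]
    rfl
  simp [h R hR, h T hT]

/-- Since `R T = 0`, the range of `T` lies in `ker R`; hence `⟪T f, g⟫ = ⟪f, T g⟫ = 0` for every
`g`. -/
theorem eq_zero_of_mem_ker_orthogonal {R T : G →L[ℂ] G} (hT : IsSelfAdjoint T) (h : R * T = 0)
    {f : G} (hf : f ∈ (LinearMap.ker R.toLinearMap)ᗮ) : T f = 0 := by
  refine ext_inner_left ℂ fun g => ?_
  rw [inner_zero_right, ← adjoint_inner_left, hT.adjoint_eq]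
  exact hf _ (DFunLike.congr_fun h g)

theorem apply_mem_ker_orthogonal {R : G →L[ℂ] G} (hR : IsSelfAdjoint R) (f : G) :
    R f ∈ (LinearMap.ker R.toLinearMap)ᗮ := by
  intro g hg
  rw [← adjoint_inner_left, hR.adjoint_eq]
  have : R g = 0 := hg
  rw [this, inner_zero_left]

omit [CompleteSpace G] in
theorem eq_zero_of_mem_ker_orthogonal_of_apply {R : G →L[ℂ] G} {f : G}
    (hf : f ∈ (LinearMap.ker R.toLinearMap)ᗮ) (h : R f = 0) : f = 0 :=
  inner_self_eq_zero.1 (hf f h)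

/-- A closed subspace on which a form is positive is at most as large as the orthogonal
complement of a closed subspace on which the form is nonpositive. -/
theorem hilbertDim_le_of_definite (q : G → ℝ) (M Q : Submodule ℂ G) [CompleteSpace M]
    [CompleteSpace Q] (hM : ∀ f ∈ M, f ≠ 0 → 0 < q f) (hQ : ∀ f ∈ Q, q f ≤ 0) :
    hilbertDim M ≤ hilbertDim Qᗮ := by
  -- The kernel of the projection onto `Qᗮ` is `Qᗮᗮ = Q`, and `M ∩ Q = 0` by the signs of `q`.
  have h := hilbertDim_le (Qᗮ.orthogonalProjectionOnto ∘L M.subtypeL) ?_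
  · simpa using h
  rw [injective_iff_map_eq_zero]
  rintro ⟨f, hf⟩ h
  have h1 : f ∈ Qᗮᗮ := Submodule.orthogonalProjectionOnto_eq_zero_iff.1 h
  rw [Submodule.orthogonal_orthogonal] at h1
  by_contra h2
  exact ((hM f hf fun h => h2 (Subtype.ext h)).trans_le (hQ f h1)).false

variable {E : Type v} [NormedAddCommGroup E] [InnerProductSpace ℂ E] [CompleteSpace E]
variable {F : Type w} [NormedAddCommGroup F] [InnerProductSpace ℂ F] [CompleteSpace F]

/-- Hilbert spaces of equal dimension are isometrically isomorphic. -/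
theorem exists_linearIsometryEquiv_of_hilbertDim_eq
    (h : Cardinal.lift.{w} (hilbertDim E) = Cardinal.lift.{v} (hilbertDim F)) :
    Nonempty (E ≃ₗᵢ[ℂ] F) := by
  obtain ⟨h1, h2⟩ := (exists_maximal_orthonormal_set E).choose_spec
  obtain ⟨h3, h4⟩ := (exists_maximal_orthonormal_set F).choose_spec
  obtain ⟨e⟩ := Cardinal.lift_mk_eq'.1 h
  rw [maximal_orthonormal_iff_orthogonalComplement_eq_bot h1] at h2
  rw [maximal_orthonormal_iff_orthogonalComplement_eq_bot h3] at h4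
  let b := HilbertBasis.mkOfOrthogonalEqBot h1 (by simpa using h2)
  let c := HilbertBasis.mkOfOrthogonalEqBot (h3.comp e e.injective)
    (by rw [EquivLike.range_comp]; simpa using h4)
  exact ⟨b.repr.trans c.repr.symm⟩

/-- An operator dominated by another one factors through it. -/
theorem exists_comp_eq_of_norm_le {Q : Type*} [NormedAddCommGroup Q] [NormedSpace ℂ Q]
    (X : Q →L[ℂ] E) (Y : Q →L[ℂ] F) (h : ∀ f, ‖X f‖ ≤ ‖Y f‖) :
    ∃ T : F →L[ℂ] E, ∀ f, T (Y f) = X f := by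
  let N := (LinearMap.range Y.toLinearMap).topologicalClosure
  have : CompleteSpace N := (Submodule.isClosed_topologicalClosure _).completeSpace_coe
  have hN : ∀ f, Y f ∈ N := fun f => Submodule.le_topologicalClosure _ ⟨f, rfl⟩
  let Z : Q →ₗ[ℂ] N := Y.toLinearMap.codRestrict N hN
  have hZ : DenseRange Z := by
    rw [DenseRange, Subtype.dense_iff]
    intro x hx
    refine closure_mono ?_ hx
    rintro _ ⟨f, rfl⟩
    exact ⟨Z f, ⟨f, rfl⟩, rfl⟩
  -- `Y f ↦ X f` is well defined and contractive on the range of `Y`; it extends by continuity to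
  -- the closure `N` and by zero to `Nᗮ`.
  refine ⟨X.toLinearMap.extendOfNorm Z ∘L N.orthogonalProjectionOnto, fun f => ?_⟩
  have h1 : N.orthogonalProjectionOnto (Y f) = Z f :=
    Submodule.orthogonalProjectionOnto_mem_subspace_eq_self (⟨Y f, hN f⟩ : N)
  rw [ContinuousLinearMap.comp_apply, h1]
  exact LinearMap.extendOfNorm_eq hZ ⟨1, fun x => by rw [one_mul]; exact h x⟩ f

/-- If the form `‖B f‖² - ‖B' f‖²` is nonpositive on `Q` and positive on its orthogonal complement
and the joint range of `B` and `B'` is dense, then the target of `B` has the dimension of the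
orthogonal complement of `Q`. -/
theorem hilbertDim_eq_of_definite (B : G →L[ℂ] E) (B' : G →L[ℂ] F) (Q : Submodule ℂ G)
    [CompleteSpace Q] (hQ : ∀ f ∈ Q, ‖B f‖ ≤ ‖B' f‖)
    (hQ' : ∀ f ∈ Qᗮ, f ≠ 0 → ‖B' f‖ < ‖B f‖)
    (hB : ∀ x y, (B†) x + (B'†) y = 0 → x = 0) :
    Cardinal.lift.{u} (hilbertDim E) = Cardinal.lift.{v} (hilbertDim Qᗮ) := by
  refine le_antisymm ?_ ?_
  · obtain ⟨T, hT⟩ := exists_comp_eq_of_norm_le (B ∘L Q.subtypeL) (B' ∘L Q.subtypeL)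
      fun f => hQ f f.2
    -- `B = T B'` on `Q` makes the range of `B† - B'† T†` orthogonal to `Q`. A vector of this range
    -- with zero projection onto `Qᗮ` also lies in `Q`, so it vanishes, and `hB` applies to the pair
    -- `x`, `-T† x`.
    refine hilbertDim_le (Qᗮ.orthogonalProjectionOnto ∘L (B† - B'† ∘L T†)) ?_
    rw [injective_iff_map_eq_zero]
    intro x hx
    have h1 : (B†) x - (B'†) ((T†) x) ∈ Qᗮᗮ :=
      Submodule.orthogonalProjectionOnto_eq_zero_iff.1 hx
    rw [Submodule.orthogonal_orthogonal] at h1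
    have h2 : (B†) x - (B'†) ((T†) x) ∈ Qᗮ := by
      intro f hf
      have h3 : T (B' f) = B f := hT ⟨f, hf⟩
      rw [inner_sub_right, adjoint_inner_right, adjoint_inner_right, adjoint_inner_right, h3,
        sub_self]
    have h3 := inner_self_eq_zero.1 (h2 _ h1)
    refine hB x (-(T†) x) ?_
    rw [map_neg, ← sub_eq_add_neg, h3]
  · refine hilbertDim_le (B ∘L Qᗮ.subtypeL) ?_
    rw [injective_iff_map_eq_zero]
    rintro ⟨f, hf⟩ h
    by_contra h2
    have h3 := hQ' f hf fun h => h2 (Subtype.ext h)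
    have h4 : B f = 0 := h
    rw [h4, norm_zero] at h3
    exact (norm_nonneg _).not_gt h3

end Hilbert

open scoped InnerProduct

/-! ### The Gram operator and the hermitian indices. -/

section Indices

variable {H : Type u} [AddCommGroup H] [Module ℂ H] [TopologicalSpace H] [KreinSpace H]

/-- The Gram operator of the form `[C x, y]` on the associated Hilbert space. -/
def gramOperator (C : H →L[ℂ] H) : (decomp H).AssocSpace →L[ℂ] (decomp H).AssocSpace :=
  (decomp H).symmetryL ∘L (decomp_isFundamental H).toAssocL.toContinuousLinearMap ∘L C ∘L
    (decomp_isFundamental H).toAssocL.symm.toContinuousLinearMap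

theorem inner_gramOperator (C : H →L[ℂ] H) (x y : H) :
    inner ℂ (gramOperator C ((decomp H).toAssoc x)) ((decomp H).toAssoc y) = form (C x) y :=
  ((decomp H).form_eq_inner_left (C x) y).symm

/-- The fundamental symmetry may be put in either argument of the inner product to recover the form,
so Kreĭn selfadjointness of `C` becomes Hilbert selfadjointness. -/
theorem isSelfAdjoint_gramOperator {C : H →L[ℂ] H} (hC : IsSelfadjoint C) :
    IsSelfAdjoint (gramOperator C) := by
  rw [ContinuousLinearMap.isSelfAdjoint_iff_isSymmetric]
  intro x y
  obtain ⟨x, rfl⟩ := (decomp H).toAssoc.surjective x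
  obtain ⟨y, rfl⟩ := (decomp H).toAssoc.surjective y
  have h : form (C x) y = form x (C y) := by
    conv_rhs => rw [← hC]
    exact form_adjoint_right C x y
  refine (inner_gramOperator C x y).trans (h.trans ?_)
  exact (decomp H).form_eq_inner_right x (C y)

/-- Orthogonal complements of suitable subspaces attain the positive hermitian index. -/
theorem isGreatest_positiveDims (C : H →L[ℂ] H) (Q : Submodule ℂ (decomp H).AssocSpace)
    [CompleteSpace Q] (hQ : ∀ f ∈ Q, (inner ℂ (gramOperator C f) f).re ≤ 0)
    (hQ' : ∀ f ∈ Qᗮ, f ≠ 0 → 0 < (inner ℂ (gramOperator C f) f).re) :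
    IsGreatest (positiveDims C) (hilbertDim Qᗮ) := by
  constructor
  · refine ⟨Qᗮ.comap (decomp H).toAssoc.toLinearMap, ?_, ?_, ?_⟩
    · exact (Submodule.isClosed_orthogonal Q).preimage
        (decomp_isFundamental H).isHomeomorph.continuous
    · intro f hf hf0
      exact (hQ' _ hf ((decomp H).toAssoc.map_ne_zero_iff.2 hf0)).trans_eq
        (congrArg _ (inner_gramOperator C f f))
    · rw [dim, DefiniteDecomposition.dim,
        Submodule.map_comap_eq_of_surjective (decomp H).toAssoc.surjective]
  · rintro _ ⟨M, hM, hpos, rfl⟩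
    have := (decomp_isFundamental H).complete_map hM
    refine hilbertDim_le_of_definite (fun f => (inner ℂ (gramOperator C f) f).re) _ Q ?_ hQ
    rintro _ ⟨f, hf, rfl⟩ h0
    exact (hpos f hf ((decomp H).toAssoc.map_ne_zero_iff.1 h0)).trans_eq
      (congrArg _ (inner_gramOperator C f f).symm)

/-- Negation on `H` must be continuous for `-C` to be a continuous operator; passing to `-C`
exchanges the two hermitian indices. -/
instance : IsTopologicalAddGroup H :=
  (decomp_isFundamental H).isHomeomorph.isInducing.topologicalAddGroup (decomp H).toAssoc

theorem positiveDims_neg (C : H →L[ℂ] H) : positiveDims (-C) = negativeDims C := by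
  simp [positiveDims, negativeDims, IsStrictlyPositive, IsStrictlyNegative]

theorem gramOperator_neg (C : H →L[ℂ] H) : gramOperator (-C) = -gramOperator C := by
  ext x
  simp [gramOperator]

end Indices

/-! ### The Hilbert space components of a Kreĭn space. -/

section Components

variable (K : Type v) [AddCommGroup K] [Module ℂ K] [TopologicalSpace K] [KreinSpace K]

/-- The Hilbert space `K₊`. -/
abbrev posSpace : Submodule ℂ (decomp K).AssocSpace :=
  (decomp K).pos.map (decomp K).toAssoc.toLinearMap

/-- The Hilbert space `K₋`, with the negative of its form. -/
abbrev negSpace : Submodule ℂ (decomp K).AssocSpace :=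
  (decomp K).neg.map (decomp K).toAssoc.toLinearMap

instance : CompleteSpace (posSpace K) :=
  (decomp_isFundamental K).complete_map (decomp_isFundamental K).isClosed_pos

instance : CompleteSpace (negSpace K) :=
  (decomp_isFundamental K).complete_map (decomp_isFundamental K).isClosed_neg

/-- The projection of a Kreĭn space onto its positive component. -/
def toPosSpace : K →L[ℂ] posSpace K :=
  ((decomp K).posPartL ∘L (decomp_isFundamental K).toAssocL.toContinuousLinearMap).codRestrict _
    fun x => ⟨_, (decomp K).posPart_mem x, rfl⟩

/-- The projection of a Kreĭn space onto its negative component. -/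
def toNegSpace : K →L[ℂ] negSpace K :=
  ((decomp K).negPartL ∘L (decomp_isFundamental K).toAssocL.toContinuousLinearMap).codRestrict _
    fun x => ⟨_, (decomp K).negPart_mem x, rfl⟩

variable {K}

theorem coe_toPosSpace (x : K) :
    (toPosSpace K x : (decomp K).AssocSpace) = (decomp K).toAssoc ((decomp K).posPart x) := rfl

theorem coe_toNegSpace (x : K) :
    (toNegSpace K x : (decomp K).AssocSpace) = (decomp K).toAssoc ((decomp K).negPart x) := rfl

/-- The form of a Kreĭn space is the difference of the inner products of the components. -/
theorem form_eq_inner_sub_inner (x y : K) :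
    form x y = inner ℂ (toPosSpace K x) (toPosSpace K y) -
      inner ℂ (toNegSpace K x) (toNegSpace K y) := by
  let D := decomp K
  rw [Submodule.coe_inner, Submodule.coe_inner, coe_toPosSpace, coe_toPosSpace, coe_toNegSpace,
    coe_toNegSpace, D.inner_def, D.inner_def, DefiniteDecomposition.assocInner,
    DefiniteDecomposition.assocInner, D.form_eq x y,
    D.posPart_of_mem_pos (D.posPart_mem x), D.posPart_of_mem_pos (D.posPart_mem y),
    D.negPart_of_mem_pos (D.posPart_mem x), D.posPart_of_mem_neg (D.negPart_mem x),
    D.negPart_of_mem_neg (D.negPart_mem x), D.negPart_of_mem_neg (D.negPart_mem y)]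
  simp

theorem exists_components_eq (a : posSpace K) (b : negSpace K) :
    ∃ x : K, toPosSpace K x = a ∧ toNegSpace K x = b := by
  obtain ⟨_, p, hp, rfl⟩ := a
  obtain ⟨_, n, hn, rfl⟩ := b
  refine ⟨p + n, Subtype.ext ?_, Subtype.ext ?_⟩
  · rw [coe_toPosSpace, map_add, DefiniteDecomposition.posPart_of_mem_pos _ hp,
      DefiniteDecomposition.posPart_of_mem_neg _ hn, add_zero]
    rfl
  · rw [coe_toNegSpace, map_add, DefiniteDecomposition.negPart_of_mem_pos _ hp,
      DefiniteDecomposition.negPart_of_mem_neg _ hn, zero_add]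
    rfl

theorem eq_zero_of_components_eq_zero {x : K} (h : toPosSpace K x = 0) (h' : toNegSpace K x = 0) :
    x = 0 := by
  have h1 : (decomp K).posPart x = 0 :=
    (decomp K).toAssoc.map_eq_zero_iff.1 (congrArg Subtype.val h)
  have h2 : (decomp K).negPart x = 0 :=
    (decomp K).toAssoc.map_eq_zero_iff.1 (congrArg Subtype.val h')
  rw [← (decomp K).posPart_add_negPart x, h1, h2, add_zero]

end Components

/-! ### Factorizations and their indices. -/

section Factorization

variable {H : Type u} [AddCommGroup H] [Module ℂ H] [TopologicalSpace H] [KreinSpace H]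
variable {K : Type v} [AddCommGroup K] [Module ℂ K] [TopologicalSpace K] [KreinSpace K]

/-- A factorization through `K` writes the form `[C f, f]` as a difference of two squares, by
operators with values in the components of `K` whose joint range is dense. -/
theorem HasBognarKramliFactorization.exists_components {C : H →L[ℂ] H}
    (h : HasBognarKramliFactorization C K) :
    ∃ (B : (decomp H).AssocSpace →L[ℂ] posSpace K) (B' : (decomp H).AssocSpace →L[ℂ] negSpace K),
      (∀ f, (inner ℂ (gramOperator C f) f).re = ‖B f‖ ^ 2 - ‖B' f‖ ^ 2) ∧
      ∀ x y, (B†) x + (B'†) y = 0 → x = 0 ∧ y = 0 := by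
  obtain ⟨A, hA, rfl⟩ := h
  let e := (decomp_isFundamental H).toAssocL
  refine ⟨toPosSpace K ∘L adjoint A ∘L e.symm.toContinuousLinearMap,
    toNegSpace K ∘L adjoint A ∘L e.symm.toContinuousLinearMap, fun f => ?_, fun x y hxy => ?_⟩
  · obtain ⟨f, rfl⟩ := (decomp H).toAssoc.surjective f
    rw [inner_gramOperator, ContinuousLinearMap.comp_apply, form_adjoint_right,
      form_eq_inner_sub_inner, Complex.sub_re]
    congr 1
    · exact inner_self_eq_norm_sq (𝕜 := ℂ) (toPosSpace K (adjoint A f))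
    · exact inner_self_eq_norm_sq (𝕜 := ℂ) (toNegSpace K (adjoint A f))
  -- The form on `K₋` is the negative of the inner product, so the sign of `y` is reversed: `[A z,
  -- f] = ⟪x, B f⟫ + ⟪y, B' f⟫ = 0`.
  · obtain ⟨z, hz, hz'⟩ := exists_components_eq x (-y)
    have hAz : A z = 0 := (decomp H).eq_zero_of_form fun f => by
      have h1 := congrArg (fun g => inner ℂ g (e f)) hxy
      simp only [inner_add_left, ContinuousLinearMap.adjoint_inner_left, inner_zero_left] at h1
      rw [form_adjoint_right, form_eq_inner_sub_inner, hz, hz', inner_neg_left, sub_neg_eq_add]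
      simpa using h1
    have hz0 : z = 0 := (LinearMap.ker_eq_bot'.1 hA) z hAz
    subst hz0
    rw [map_zero] at hz hz'
    exact ⟨hz.symm, neg_eq_zero.1 hz'.symm⟩

/-- Operators to the components of `K` whose difference of squares is the form `[C x, y]` and
whose adjoints are jointly injective define a factorization through `K`. -/
theorem hasBognarKramliFactorization_of_components {C : H →L[ℂ] H}
    (B : (decomp H).AssocSpace →L[ℂ] posSpace K) (B' : (decomp H).AssocSpace →L[ℂ] negSpace K)
    (hB : B† ∘L B - B'† ∘L B' = gramOperator C)
    (hinj : ∀ x y, (B†) x = (B'†) y → x = 0 ∧ y = 0) : HasBognarKramliFactorization C K := by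
  let e := (decomp_isFundamental H).toAssocL
  -- Chosen so that `A*` has components `B` and `B'`: the symmetry turns the form of `H` into the
  -- inner product, and the minus sign matches the form of `K₋`.
  let A : K →L[ℂ] H := e.symm.toContinuousLinearMap ∘L (decomp H).symmetryL ∘L
    (B† ∘L toPosSpace K - B'† ∘L toNegSpace K)
  have hAe (x : K) : e (A x) =
      (decomp H).symmetry ((B†) (toPosSpace K x) - (B'†) (toNegSpace K x)) := rfl
  have hA (x : K) (f : H) : form (A x) f =
      inner ℂ (toPosSpace K x) (B (e f)) - inner ℂ (toNegSpace K x) (B' (e f)) := by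
    rw [(decomp H).form_eq_inner_left]
    change inner ℂ ((decomp H).symmetry (e (A x))) (e f) = _
    rw [hAe, DefiniteDecomposition.symmetry_symmetry, inner_sub_left,
      ContinuousLinearMap.adjoint_inner_left, ContinuousLinearMap.adjoint_inner_left]
  have hadj (f : H) :
      toPosSpace K (adjoint A f) = B (e f) ∧ toNegSpace K (adjoint A f) = B' (e f) := by
    -- `z` is the expected value of `A* f`; nondegeneracy of the form of `K` identifies the two.
    obtain ⟨z, hz, hz'⟩ := exists_components_eq (B (e f)) (B' (e f))
    have : adjoint A f - z = 0 := (decomp K).eq_zero_of_form fun y => by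
      rw [form, ← IndefiniteInnerProductSpace.conj_form_symm]
      change (starRingEnd ℂ) (form y (adjoint A f - z)) = 0
      rw [map_sub, ← form_adjoint_right, hA, form_eq_inner_sub_inner y z, hz, hz', sub_self,
        map_zero]
    rw [sub_eq_zero.1 this]
    exact ⟨hz, hz'⟩
  refine ⟨A, LinearMap.ker_eq_bot'.2 fun x hx => ?_, ?_⟩
  · have hx' : A x = 0 := hx
    have h1 := hAe x
    rw [hx', map_zero] at h1
    have h2 := congrArg (decomp H).symmetry h1
    rw [DefiniteDecomposition.symmetry_symmetry, map_zero] at h2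
    obtain ⟨h3, h4⟩ := hinj _ _ (sub_eq_zero.1 h2.symm)
    exact eq_zero_of_components_eq_zero h3 h4
  · ext f
    apply e.injective
    rw [ContinuousLinearMap.comp_apply, hAe, (hadj f).1, (hadj f).2]
    have h1 : (B†) (B (e f)) - (B'†) (B' (e f)) = (decomp H).symmetry (e (C f)) :=
      DFunLike.congr_fun hB (e f)
    rw [h1, DefiniteDecomposition.symmetry_symmetry]

/-- For a selfadjoint `R` and a unitary `U` from `(ker R)ᗮ` to `E`, the operator `B = U R`
satisfies `B† B = R²`, and its adjoint is injective with range in `(ker R)ᗮ`. -/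
theorem exists_adjoint_comp_self_eq {G : Type u} [NormedAddCommGroup G] [InnerProductSpace ℂ G]
    [CompleteSpace G] {E : Type v} [NormedAddCommGroup E] [InnerProductSpace ℂ E]
    [CompleteSpace E] {R : G →L[ℂ] G} (hR : IsSelfAdjoint R)
    (U : (LinearMap.ker R.toLinearMap)ᗮ ≃ₗᵢ[ℂ] E) :
    ∃ B : G →L[ℂ] E, B† ∘L B = R * R ∧
      ∀ x, (B†) x ∈ (LinearMap.ker R.toLinearMap)ᗮ ∧ ((B†) x = 0 → x = 0) := by
  let R' := R.codRestrict _ (apply_mem_ker_orthogonal hR)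
  let B : G →L[ℂ] E := U.toContinuousLinearEquiv.toContinuousLinearMap ∘L R'
  have hB (x : E) : (B†) x = R (U.symm x) := by
    refine ext_inner_right ℂ fun y => ?_
    rw [ContinuousLinearMap.adjoint_inner_left, ← ContinuousLinearMap.adjoint_inner_right R,
      hR.adjoint_eq]
    change inner ℂ x (U (R' y)) = inner ℂ (U.symm x) (R' y)
    rw [← U.inner_map_map, U.apply_symm_apply]
  refine ⟨B, ?_, fun x => ⟨?_, fun h => ?_⟩⟩
  · ext f
    rw [ContinuousLinearMap.comp_apply, hB]
    change R (U.symm (U (R' f))) = R (R f)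
    rw [U.symm_apply_apply]
    rfl
  · rw [hB]
    exact apply_mem_ker_orthogonal hR _
  · rw [hB] at h
    have h1 := eq_zero_of_mem_ker_orthogonal_of_apply (U.symm x).2 h
    exact U.symm.map_eq_zero_iff.1 (Subtype.ext h1)

/-- If `R T = 0`, the form `‖R f‖² - ‖T f‖²` is positive on the orthogonal complement of the
kernel of `R`. -/
theorem norm_lt_of_mem_ker_orthogonal {G : Type u} [NormedAddCommGroup G] [InnerProductSpace ℂ G]
    [CompleteSpace G] {R T : G →L[ℂ] G} (hT : IsSelfAdjoint T) (hRT : R * T = 0) {f : G}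
    (hf : f ∈ (LinearMap.ker R.toLinearMap)ᗮ) (hf0 : f ≠ 0) : ‖T f‖ < ‖R f‖ := by
  rw [eq_zero_of_mem_ker_orthogonal hT hRT hf, norm_zero, norm_pos_iff]
  exact fun h => hf0 (eq_zero_of_mem_ker_orthogonal_of_apply hf h)

theorem norm_le_of_mem_ker {G : Type u} [NormedAddCommGroup G] [InnerProductSpace ℂ G]
    {R T : G →L[ℂ] G} {f : G} (hf : f ∈ LinearMap.ker R.toLinearMap) : ‖R f‖ ≤ ‖T f‖ := by
  have h : R f = 0 := hf
  rw [h, norm_zero]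
  exact norm_nonneg _

instance completeSpace_ker {G : Type u} [NormedAddCommGroup G] [InnerProductSpace ℂ G]
    [CompleteSpace G] (R : G →L[ℂ] G) : CompleteSpace (LinearMap.ker R.toLinearMap) :=
  R.isClosed_ker.completeSpace_coe

variable {C : H →L[ℂ] H} {R T : (decomp H).AssocSpace →L[ℂ] (decomp H).AssocSpace}

theorem isGreatest_positiveDims_of_eq_sub (hR : IsSelfAdjoint R) (hT : IsSelfAdjoint T)
    (h : R * R - T * T = gramOperator C) (hRT : R * T = 0) :
    IsGreatest (positiveDims C) (hilbertDim (LinearMap.ker R.toLinearMap)ᗮ) := by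
  refine isGreatest_positiveDims C _ (fun f hf => ?_) fun f hf hf0 => ?_ <;>
    rw [← h, inner_sub_sq_apply hR hT]
  · exact sub_nonpos.2 (pow_le_pow_left₀ (norm_nonneg _) (norm_le_of_mem_ker hf) 2)
  · exact sub_pos.2 (pow_lt_pow_left₀ (norm_lt_of_mem_ker_orthogonal hT hRT hf hf0)
      (norm_nonneg _) two_ne_zero)

theorem isGreatest_negativeDims_of_eq_sub (hR : IsSelfAdjoint R) (hT : IsSelfAdjoint T)
    (h : R * R - T * T = gramOperator C) (hTR : T * R = 0) :
    IsGreatest (negativeDims C) (hilbertDim (LinearMap.ker T.toLinearMap)ᗮ) := by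
  rw [← positiveDims_neg]
  refine isGreatest_positiveDims_of_eq_sub hT hR ?_ hTR
  rw [gramOperator_neg, ← h, neg_sub]

/-- The pairs `R`, `T` and `B`, `B'` represent the same quadratic form, so the signs known on `ker
R` and `(ker R)ᗮ` carry over to `B`, `B'`, and `hilbertDim_eq_of_definite` applies. Exchanging the
roles in both pairs gives the negative index. -/
theorem HasBognarKramliFactorization.index_eq (hK : HasBognarKramliFactorization C K)
    (hR : IsSelfAdjoint R) (hT : IsSelfAdjoint T) (h : R * R - T * T = gramOperator C)
    (hRT : R * T = 0) (hTR : T * R = 0) :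
    Cardinal.lift.{u} (posIndex K) =
        Cardinal.lift.{v} (hilbertDim (LinearMap.ker R.toLinearMap)ᗮ) ∧
      Cardinal.lift.{u} (negIndex K) =
        Cardinal.lift.{v} (hilbertDim (LinearMap.ker T.toLinearMap)ᗮ) := by
  obtain ⟨B, B', hB, hinj⟩ := hK.exists_components
  have hsq (f) : ‖R f‖ ^ 2 - ‖T f‖ ^ 2 = ‖B f‖ ^ 2 - ‖B' f‖ ^ 2 := by
    rw [← hB, ← h, inner_sub_sq_apply hR hT]
  have hle {a b c d : ℝ} (ha : 0 ≤ a) (hd : 0 ≤ d) (h : a ^ 2 - b ^ 2 = c ^ 2 - d ^ 2)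
      (hab : a ≤ b) : c ≤ d :=
    le_of_sq_le_sq (by have := pow_le_pow_left₀ ha hab 2; linarith) hd
  have hlt {a b c d : ℝ} (hb : 0 ≤ b) (hc : 0 ≤ c) (h : a ^ 2 - b ^ 2 = c ^ 2 - d ^ 2)
      (hab : b < a) : d < c :=
    lt_of_pow_lt_pow_left₀ 2 hc (by have := pow_lt_pow_left₀ hab hb two_ne_zero; linarith)
  constructor
  · exact hilbertDim_eq_of_definite B B' (LinearMap.ker R.toLinearMap)
      (fun f hf => hle (norm_nonneg _) (norm_nonneg _) (hsq f) (norm_le_of_mem_ker hf))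
      (fun f hf hf0 => hlt (norm_nonneg _) (norm_nonneg _) (hsq f)
        (norm_lt_of_mem_ker_orthogonal hT hRT hf hf0))
      fun x y hxy => (hinj x y hxy).1
  · have hsq' (f) : ‖T f‖ ^ 2 - ‖R f‖ ^ 2 = ‖B' f‖ ^ 2 - ‖B f‖ ^ 2 := by linarith [hsq f]
    exact hilbertDim_eq_of_definite B' B (LinearMap.ker T.toLinearMap)
      (fun f hf => hle (norm_nonneg _) (norm_nonneg _) (hsq' f) (norm_le_of_mem_ker hf))
      (fun f hf hf0 => hlt (norm_nonneg _) (norm_nonneg _) (hsq' f)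
        (norm_lt_of_mem_ker_orthogonal hR hTR hf hf0))
      fun x y hxy => (hinj y x (by rwa [add_comm])).2

theorem hasBognarKramliFactorization_of_index_eq
    (hR : IsSelfAdjoint R) (hT : IsSelfAdjoint T) (h : R * R - T * T = gramOperator C)
    (hRT : R * T = 0)
    (hpos : Cardinal.lift.{u} (posIndex K) =
      Cardinal.lift.{v} (hilbertDim (LinearMap.ker R.toLinearMap)ᗮ))
    (hneg : Cardinal.lift.{u} (negIndex K) =
      Cardinal.lift.{v} (hilbertDim (LinearMap.ker T.toLinearMap)ᗮ)) :
    HasBognarKramliFactorization C K := by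
  obtain ⟨U⟩ : Nonempty ((LinearMap.ker R.toLinearMap)ᗮ ≃ₗᵢ[ℂ] posSpace K) :=
    exists_linearIsometryEquiv_of_hilbertDim_eq hpos.symm
  obtain ⟨U'⟩ : Nonempty ((LinearMap.ker T.toLinearMap)ᗮ ≃ₗᵢ[ℂ] negSpace K) :=
    exists_linearIsometryEquiv_of_hilbertDim_eq hneg.symm
  obtain ⟨B, hB, hB'⟩ := exists_adjoint_comp_self_eq hR U
  obtain ⟨B', hBn, hBn'⟩ := exists_adjoint_comp_self_eq hT U'
  refine hasBognarKramliFactorization_of_components B B' (by rw [hB, hBn, h]) fun x y hxy => ?_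
  -- The common vector `B† x = B'† y` lies in `(ker R)ᗮ`, where `T` vanishes, and in `(ker T)ᗮ`,
  -- where `T` is injective; so it is zero.
  have h1 : T ((B'†) y) = 0 := by
    rw [← hxy]
    exact eq_zero_of_mem_ker_orthogonal hT hRT (hB' x).1
  have h2 := eq_zero_of_mem_ker_orthogonal_of_apply (hBn' y).1 h1
  exact ⟨(hB' x).2 (hxy.trans h2), (hBn' y).2 h2⟩

end Factorization

end Krein

end

/-! ### The factorization theorem. -/

theorem theorem3p1
    {H : Type u} [AddCommGroup H] [Module ℂ H] [TopologicalSpace H] [KreinSpace H]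
    (C : H →L[ℂ] H) (hC : Krein.IsSelfadjoint C) :
    -- the maxima defining the hermitian indices are attained
    IsGreatest (Krein.positiveDims C) (Krein.posHermitianIndex C) ∧
    IsGreatest (Krein.negativeDims C) (Krein.negHermitianIndex C) ∧
    -- `C` factors through `K` exactly when the indices of `K` are the hermitian indices of `C`
    (∀ (K : Type v) [AddCommGroup K] [Module ℂ K] [TopologicalSpace K] [KreinSpace K],
      Krein.HasBognarKramliFactorization C K ↔
        Cardinal.lift.{u} (Krein.posIndex K) = Cardinal.lift.{v} (Krein.posHermitianIndex C) ∧
        Cardinal.lift.{u} (Krein.negIndex K) = Cardinal.lift.{v} (Krein.negHermitianIndex C)) ∧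
    -- the indices do not depend on the factorization
    (∀ (K : Type v) [AddCommGroup K] [Module ℂ K] [TopologicalSpace K] [KreinSpace K]
      (L : Type w) [AddCommGroup L] [Module ℂ L] [TopologicalSpace L] [KreinSpace L],
      Krein.HasBognarKramliFactorization C K → Krein.HasBognarKramliFactorization C L →
        Cardinal.lift.{w} (Krein.posIndex K) = Cardinal.lift.{v} (Krein.posIndex L) ∧
        Cardinal.lift.{w} (Krein.negIndex K) = Cardinal.lift.{v} (Krein.negIndex L)) := by
  obtain ⟨R, T, hR, hT, h, hRT, hTR⟩ :=
    Krein.exists_eq_sub_of_isSelfAdjoint _ (Krein.isSelfAdjoint_gramOperator hC)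
  have hg := Krein.isGreatest_positiveDims_of_eq_sub hR hT h hRT
  have hg' := Krein.isGreatest_negativeDims_of_eq_sub hR hT h hTR
  rw [Krein.posHermitianIndex, Krein.negHermitianIndex, hg.csSup_eq, hg'.csSup_eq]
  refine ⟨hg, hg', ?_, ?_⟩
  · intro K _ _ _ _
    exact ⟨fun hK => hK.index_eq hR hT h hRT hTR, fun hK =>
      Krein.hasBognarKramliFactorization_of_index_eq hR hT h hRT hK.1 hK.2⟩
  · intro K _ _ _ _ L _ _ _ _ hK hL
    obtain ⟨h1, h2⟩ := hK.index_eq hR hT h hRT hTR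
    obtain ⟨h3, h4⟩ := hL.index_eq hR hT h hRT hTR
    -- Both indices are compared with a cardinal in the universe of `H`; the equalities are lifted
    -- to a common universe and the extra lift is cancelled by injectivity.
    have key {a : Cardinal.{v}} {b : Cardinal.{w}} {c : Cardinal.{u}}
        (h1 : Cardinal.lift.{u} a = Cardinal.lift.{v} c)
        (h2 : Cardinal.lift.{u} b = Cardinal.lift.{w} c) :
        Cardinal.lift.{w} a = Cardinal.lift.{v} b := by
      have h3 := congrArg Cardinal.lift.{w} h1
      have h4 := congrArg Cardinal.lift.{v} h2
      rw [Cardinal.lift_lift, Cardinal.lift_lift] at h3 h4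
      rw [← Cardinal.lift_inj.{_, u}, Cardinal.lift_lift, Cardinal.lift_lift]
      exact h3.trans h4.symm
    exact ⟨key h1 h3, key h2 h4⟩
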